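/- Let $\mathcal P$ be a poset, regarded as a category with one arrow $p\to q$ if and only if $p\le q$. For $p<p'$ say that $p$ precedes $p'$ if no element lies strictly between them. Assume that $\mathcal P$ is graded with degree function $\deg:\mathcal P\to\mathbb Z_{\ge 0}$, i.e. $\deg$ is order reversing and $\deg(p)=\deg(p')+1$ whenever $p$ precedes $p'$, and that $\{p\mid p_0\le p\}$ is finite for every $p_0$. Write $\mathrm{Ob}_n=\{p\mid \deg p=n\}$, $(p_0\downarrow\mathcal P)_n=\{p\ge p_0\mid \deg p=n\}$ and $(p_0\downarrow\mathcal P)_*=\{p\mid p>p_0\}$. Define integers by $R_0^{p_0}=1$ and $R_n^{p_0}=\sum_{p\in(p_0\downarrow\mathcal P)_{n-1}}R_{n-1}^p-R_{n-1}^{p_0}$ for $n\ge1$ (used for $\deg(p_0)\ge n$). A local covering family consists of subsets $J_n^{p_0}\subseteq(p_0\downarrow\mathcal P)_n$ for $p_0\in\mathcal P$, $0\le n\le\deg(p_0)$, such that for all $p_0$ and $0\le n<\deg(p_0)$: $\bigcup_{p\in J_{n+1}^{p_0}}(p\downarrow\mathcal P)_n=(p_0\downarrow\mathcal P)_n$,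 and $J_n^p\subseteq J_n^{p_0}$ for all $p\in J_{n+1}^{p_0}$. It is adequate if $(p_0\downarrow\mathcal P)_*$ is connected whenever $\deg(p_0)\ge2$, and $R_n^{p_0}=\sum_{p\in J_n^{p_0}}R_n^p$ whenever $n\ge0$ and $\deg(p_0)\ge n+1$. For a functor $F:\mathcal P\to\mathrm{Ab}$ let $\mathrm{Ker}_F(p_0)=\bigcap_{p>p_0}\ker F(p_0\to p)$, and let $\mathrm{Ker}'_F:\mathcal P\to\mathrm{Ab}$ be the functor $p_0\mapsto\prod_{p\ge p_0}\mathrm{Ker}_F(p)$, with the projections as its maps. Call $F$ $n$-condensed if $F(p)=0$ for $\deg p<n$ and $\mathrm{Ker}_F(p)=0$ for $\deg p>n$; then $\mathrm{Ker}_F(p)=F(p)$ for $\deg p=n$, and there is a natural map $\lambda_n:F\to\mathrm{Ker}'_F$ whose component at $p_0$ sends $x$ to the family with entry $F(p_0\to p)(x)$ at each $p\ge p_0$ of degree $n$ and all other entries zero. Suppose that $\mathcal P$ admits an adequate local covering family. Let $F_0=c_{\mathbb Z}$ be the constant functor with value $\mathbb Z$, and inductively let $\pi_{n+1}:\mathrm{Ker}'_{F_n}\to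 F_{n+1}$ be the cokernel of $\lambda_n:F_n\to\mathrm{Ker}'_{F_n}$. Then: 1. For every $n\ge0$, $F_n$ is $n$-condensed, $0\to F_n\xrightarrow{\lambda_n}\mathrm{Ker}'_{F_n}\xrightarrow{\pi_{n+1}}F_{n+1}\to0$ is exact, each $F_n(p)$ is a finitely generated free abelian group, and $\mathrm{rk}\,F_n(p)=R_n^p$ if $\deg(p)\ge n$. 2. The groups and maps $$0\to\prod_{p\in\mathrm{Ob}_0}F_0(p)\xrightarrow{d_0}\prod_{p\in\mathrm{Ob}_1}F_1(p)\xrightarrow{d_1}\prod_{p\in\mathrm{Ob}_2}F_2(p)\xrightarrow{d_2}\cdots$$ form a cochain complex, where $d_n$ is the composite of $\prod_{p\in\mathrm{Ob}_n}F_n(p)\cong\varprojlim\mathrm{Ker}'_{F_n}\to\varprojlim F_{n+1}$ induced by $\pi_{n+1}$ and $\varprojlim F_{n+1}\to\varprojlim\mathrm{Ker}'_{F_{n+1}}\cong\prod_{q\in\mathrm{Ob}_{n+1}}F_{n+1}(q)$ induced by $\lambda_{n+1}$; explicitly, $(d_nx)_q=(\pi_{n+1})_q\big((x_p)_{p\ge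 q,\ \deg p=n}\big)$, the entries at $p\ge q$ of degree other than $n$ being zero. For every $n\ge 0$ its $n$-th cohomology is isomorphic to $H^n(\mathcal P;\mathbb Z)=\varprojlim^n c_{\mathbb Z}$, where $\varprojlim^n$ is the $n$-th right derived functor of $\varprojlim:\mathrm{Ab}^{\mathcal P}\to\mathrm{Ab}$. 3. If $\mathrm{Ob}_n$ is finite, then $\prod_{p\in\mathrm{Ob}_n}F_n(p)$ is a finitely generated free abelian group of rank $\sum_{p\in\mathrm{Ob}_n}R_n^p$. -/

import Mathlib

open CategoryTheory CategoryTheory.Limits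

universe u

namespace GradedPoset

section

variable {P : Type u} [PartialOrder P]

/-! ### Graded posets

A poset is regarded as a category with one arrow `p ⟶ q` exactly when `p ≤ q`. -/

/-- `deg` is a degree function on the poset `P`: it reverses the order, and
`deg p = deg p' + 1` whenever `p` precedes `p'`, i.e. `p < p'` with nothing strictly between. -/
structure IsDegreeFunction (deg : P → ℕ) : Prop where
  antitone : Antitone deg
  deg_eq_of_covBy : ∀ ⦃p p' : P⦄, p ⋖ p' → deg p = deg p' + 1

/-- The set of objects `p ≥ p₀` of degree `n`. -/
def aboveOfDeg (deg : P → ℕ) (p₀ : P) (n : ℕ) : Set P := {p | p₀ ≤ p ∧ deg p = n}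

/-- The numbers `R n p₀`: `R 0 p₀ = 1` and
`R (n + 1) p₀ = (∑ R n p over p ≥ p₀ of degree n) - R n p₀`.
They are meaningful for `n ≤ deg p₀`, and when the sets `{p | p₀ ≤ p}` are finite. -/
noncomputable def R (deg : P → ℕ) : ℕ → P → ℤ
  | 0, _ => 1
  | n + 1, p₀ => (∑ᶠ p ∈ aboveOfDeg deg p₀ n, R deg n p) - R deg n p₀

/-- `J p₀ n` (for `n ≤ deg p₀`) is a local covering family. -/
structure IsLocalCoveringFamily (deg : P → ℕ) (J : P → ℕ → Set P) : Prop where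
  subset : ∀ (p₀ : P) (n : ℕ), n ≤ deg p₀ → J p₀ n ⊆ aboveOfDeg deg p₀ n
  cover : ∀ (p₀ : P) (n : ℕ), n < deg p₀ →
    ⋃ p ∈ J p₀ (n + 1), aboveOfDeg deg p n = aboveOfDeg deg p₀ n
  mono : ∀ (p₀ : P) (n : ℕ), n < deg p₀ → ∀ p ∈ J p₀ (n + 1), J p n ⊆ J p₀ n

/-- A family `J` is adequate if `{p | p₀ < p}` is connected (as a category) for `deg p₀ ≥ 2`
and `R n p₀` is the sum of `R n p` over `p ∈ J p₀ n` whenever `deg p₀ ≥ n + 1`. -/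
structure IsAdequate (deg : P → ℕ) (J : P → ℕ → Set P) : Prop where
  connected : ∀ p₀ : P, 2 ≤ deg p₀ → IsConnected (Set.Ioi p₀)
  rank_eq : ∀ (n : ℕ) (p₀ : P), n + 1 ≤ deg p₀ → R deg n p₀ = ∑ᶠ p ∈ J p₀ n, R deg n p

/-! ### Functors on a poset -/

/-- The constant functor `c_ℤ`. -/
abbrev constZ (P : Type u) [PartialOrder P] : P ⥤ AddCommGrpCat.{u} :=
  (Functor.const P).obj (AddCommGrpCat.of (ULift.{u} ℤ))

instance : EnoughInjectives (P ⥤ AddCommGrpCat.{u}) :=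
  haveI : IsGrothendieckAbelian.{u} (Pᵒᵖᵒᵖ ⥤ AddCommGrpCat.{u}) :=
    { ab5OfSize := { ofShape := fun _ => inferInstance } }
  EnoughInjectives.of_equivalence (opOpEquivalence P).symm.congrLeft.functor

instance : (lim : (P ⥤ AddCommGrpCat.{u}) ⥤ AddCommGrpCat.{u}).Additive :=
  haveI : (Functor.const P : AddCommGrpCat.{u} ⥤ (P ⥤ AddCommGrpCat.{u})).Additive :=
    { map_add := rfl }
  constLimAdj.right_adjoint_additive

/-- `H^n(P; ℤ) = lim^n c_ℤ`, with `lim^n` the right derived functors of the inverse limit. -/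
noncomputable def cohomology (P : Type u) [PartialOrder P] (n : ℕ) : AddCommGrpCat.{u} :=
  ((lim : (P ⥤ AddCommGrpCat.{u}) ⥤ AddCommGrpCat.{u}).rightDerived n).obj (constZ P)

/-- `Ker_F(p₀)`, the intersection of the kernels of `F(p₀ ⟶ p)` over all `p > p₀`. -/
def kerAt (F : P ⥤ AddCommGrpCat.{u}) (p₀ : P) : AddSubgroup (F.obj p₀) :=
  ⨅ p : Set.Ioi p₀, (F.map (homOfLE (le_of_lt p.2))).hom.ker

/-- The functor `F'`, which only depends on the values `A p = F(p)` on objects: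
`F'(p₀) = ∏_{p ≥ p₀} A p`, and `F'(p₁ ⟶ p₀)` is the projection onto the factors `p ≥ p₀`. -/
def coinduced (A : P → Type u) [∀ p, AddCommGroup (A p)] : P ⥤ AddCommGrpCat.{u} where
  obj p₀ := AddCommGrpCat.of (∀ p : Set.Ici p₀, A p)
  map {p₁ p₀} f := AddCommGrpCat.ofHom
    (AddMonoidHom.mk' (fun (x : ∀ p : Set.Ici p₁, A p) (p : Set.Ici p₀) =>
      x ⟨p.1, le_trans (leOfHom f) p.2⟩) (fun _ _ => rfl))

/-- The functor `Ker'_F`, with `Ker'_F(p₀) = ∏_{p ≥ p₀} Ker_F(p)`. -/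
abbrev kerPrime (F : P ⥤ AddCommGrpCat.{u}) : P ⥤ AddCommGrpCat.{u} :=
  coinduced fun p => kerAt F p

/-- `F` is `n`-condensed. -/
structure IsCondensed (deg : P → ℕ) (n : ℕ) (F : P ⥤ AddCommGrpCat.{u}) : Prop where
  zero_of_lt : ∀ p, deg p < n → Subsingleton (F.obj p)
  ker_eq_bot : ∀ p, n < deg p → kerAt F p = ⊥

open Classical in
/-- The map `τ_p : F(p) → Ker_F(p)`: the identity if `deg p = n` and zero otherwise.
If `F` is `n`-condensed (the only case of interest) then `Ker_F(p) = F(p)` for `deg p = n`;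
to have a total definition, `τ_p` is set to zero if this equality fails. -/
noncomputable def tau (deg : P → ℕ) (n : ℕ) (F : P ⥤ AddCommGrpCat.{u}) (p : P) :
    F.obj p →+ kerAt F p :=
  if h : deg p = n ∧ kerAt F p = ⊤ then
    AddMonoidHom.mk' (fun x => ⟨x, by rw [h.2]; trivial⟩) (fun _ _ => rfl)
  else 0

/-- The natural transformation `λ : F ⟶ Ker'_F` given by the maps `τ_p`: its component at `p₀`
sends `x` to the family of all `τ_p (F(p₀ ⟶ p) x)`, `p ≥ p₀`. -/
noncomputable def lam (deg : P → ℕ) (n : ℕ) (F : P ⥤ AddCommGrpCat.{u}) : F ⟶ kerPrime F where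
  app p₀ := AddCommGrpCat.ofHom
    (AddMonoidHom.mk' (fun (x : F.obj p₀) (p : Set.Ici p₀) =>
      tau deg n F p ((F.map (homOfLE p.2)).hom x)) (fun x y => by funext p; simp))
  naturality p₁ p₀ f := by
    ext x
    funext p
    change tau deg n F p ((F.map (homOfLE p.2)).hom ((F.map f).hom x)) =
      tau deg n F p ((F.map (homOfLE _)).hom x)
    rw [← AddCommGrpCat.comp_apply, ← F.map_comp]
    rfl

/-- The sequence of functors `F₀ = c_ℤ, F₁, F₂, …`, where `F_{n+1}` is the cokernel of
`λ_n : F_n ⟶ Ker'_{F_n}`. -/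
noncomputable def seq (deg : P → ℕ) : ℕ → (P ⥤ AddCommGrpCat.{u})
  | 0 => constZ P
  | n + 1 => cokernel (lam deg n (seq deg n))

/-- The projection `π_{n+1} : Ker'_{F_n} ⟶ F_{n+1}`. -/
noncomputable def proj (deg : P → ℕ) (n : ℕ) : kerPrime (seq deg n) ⟶ seq deg (n + 1) :=
  cokernel.π (lam deg n (seq deg n))

lemma lam_proj (deg : P → ℕ) (n : ℕ) : lam deg n (seq deg n) ≫ proj deg n = 0 :=
  cokernel.condition _

/-- The sequence `0 ⟶ F_n ⟶ Ker'_{F_n} ⟶ F_{n+1} ⟶ 0`. -/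
noncomputable def seqShortComplex (deg : P → ℕ) (n : ℕ) :
    ShortComplex (P ⥤ AddCommGrpCat.{u}) :=
  ShortComplex.mk (lam deg n (seq deg n)) (proj deg n) (lam_proj deg n)

/-! ### The cochain complex -/

/-- The group `∏ F_n(p)` over the objects `p` of degree `n`. -/
noncomputable abbrev term (deg : P → ℕ) (n : ℕ) : AddCommGrpCat.{u} :=
  AddCommGrpCat.of (∀ p : {p : P // deg p = n}, (seq deg n).obj p.1)

/-- The map `∏_{deg p = n} F_n(p) → Ker'_{F_n}(q)`, `x ↦ (x_p)` for `p ≥ q`, `deg p = n` (all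
other coordinates being zero). These are the components of the identification of
`∏_{deg p = n} F_n(p)` with the inverse limit of `Ker'_{F_n}`. -/
noncomputable def toKerPrime (deg : P → ℕ) (n : ℕ) (q : P) :
    term deg n →+ (kerPrime (seq deg n)).obj q :=
  AddMonoidHom.pi fun p : Set.Ici q =>
    if h : deg p.1 = n then
      (tau deg n (seq deg n) p.1).comp
        (Pi.evalAddMonoidHom (fun p : {p : P // deg p = n} => (seq deg n).obj p.1) ⟨p.1, h⟩)
    else 0

/-- The element `(π_{n+1})_q (x_p)_{p ≥ q, deg p = n}` of `F_{n+1}(q)`, for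
`x ∈ ∏_{deg p = n} F_n(p)`; for varying `q` these form the image of `x` in the inverse limit of
`F_{n+1}`. -/
noncomputable def toLim (deg : P → ℕ) (n : ℕ) (q : P) :
    term deg n →+ (seq deg (n + 1)).obj q :=
  ((proj deg n).app q).hom.comp (toKerPrime deg n q)

/-- The differential `d_n : ∏_{deg p = n} F_n(p) ⟶ ∏_{deg q = n + 1} F_{n+1}(q)`, the composite
of `∏_{deg p = n} F_n(p) ≅ lim Ker'_{F_n} ⟶ lim F_{n+1}` with
`lim F_{n+1} ⟶ lim Ker'_{F_{n+1}} ≅ ∏_{deg q = n + 1} F_{n+1}(q)`. -/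
noncomputable def d (deg : P → ℕ) (n : ℕ) : term deg n ⟶ term deg (n + 1) :=
  AddCommGrpCat.ofHom
    (AddMonoidHom.mk' (fun x (q : {q : P // deg q = n + 1}) => toLim deg n q.1 x)
      (fun x y => by funext q; exact map_add _ _ _))

lemma map_toLim (deg : P → ℕ) (n : ℕ) {r q : P} (f : r ⟶ q) (x : term deg n) :
    ((seq deg (n + 1)).map f).hom (toLim deg n r x) = toLim deg n q x := by
  change ((proj deg n).app r ≫ (seq deg (n + 1)).map f).hom (toKerPrime deg n r x) = _
  rw [← (proj deg n).naturality f]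
  rfl

lemma d_comp_d (deg : P → ℕ) (n : ℕ) : d deg n ≫ d deg (n + 1) = 0 := by
  ext x r
  change ((proj deg (n + 1)).app r.1).hom (toKerPrime deg (n + 1) r.1 ((d deg n).hom x)) = 0
  have key : toKerPrime deg (n + 1) r.1 ((d deg n).hom x) =
      ((lam deg (n + 1) (seq deg (n + 1))).app r.1).hom (toLim deg n r.1 x) := by
    funext p
    change (if h : deg p.1 = n + 1 then _ else 0 : term deg (n + 1) →+ _) ((d deg n).hom x) =
      tau deg (n + 1) _ p.1 (((seq deg (n + 1)).map (homOfLE p.2)).hom (toLim deg n r.1 x))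
    rw [map_toLim]
    split_ifs with h
    · rfl
    · simp [tau, h]
  rw [key]
  have h := congrArg (fun t => (t.app r.1).hom (toLim deg n r.1 x)) (lam_proj deg (n + 1))
  exact h

/-- The cochain complex `0 ⟶ ∏_{deg p = 0} F₀(p) ⟶ ∏_{deg p = 1} F₁(p) ⟶ …`. -/
noncomputable def complex (deg : P → ℕ) : CochainComplex AddCommGrpCat.{u} ℕ :=
  CochainComplex.of (term deg) (d deg) (d_comp_d deg)

end

end GradedPoset

/-! The induction carries more than the statement: for `deg p > n`, restriction identifies `F_n(p)`
with the product of the `F_n(q)`, `q ∈ J p n`. Granting this for `n`, every class in `F_{n+1}(p)`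
has exactly one representative in `∏ Ker_{F_n}` vanishing on `J p n` (`exists_normalForm`,
`normalForm_eq_zero`). So `F_{n+1}(p)` is a subgroup of a finitely generated free group, and
additivity of ranks gives the recursion for `R`. For `deg p > n + 1`, normal forms at `p` restrict
to normal forms along `J p (n + 1)`, and by the covering condition these restrictions see every
coordinate of degree `n`; hence restriction to `J p (n + 1)` is injective on `F_{n+1}(p)`. Source
and target have equal rank by adequacy, and the image is saturated because normal forms can be
divided coordinatewise (`exists_restrict_eq_of_smul`), so restriction is bijective.

For the cohomology, `lim` is `Hom(c_ℤ, -)` and its derived functors are `Ext(c_ℤ, -)`. The functors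
`Ker'` are coinduced, hence acyclic (`subsingleton_ext_coinduced`), and dimension shifting presents
`Ext^{n+1}(c_ℤ, c_ℤ)` as the cokernel of `lim Ker'_{F_n} ⟶ lim F_{n+1}`. Injectivity of the `λ`
makes `lim F_{n+1}` the group of cycles (`d_hom_eq_zero_iff`), and the image of `lim Ker'_{F_n}` is
the group of boundaries (`exists_d_eq_restrictDegree_iff`). -/

/-- An injective map of finitely generated abelian groups of equal rank is surjective
when its image is saturated. -/
lemma LinearMap.surjective_of_finrank_eq_of_saturated {A B : Type*} [AddCommGroup A]
    [AddCommGroup B] [Module.Finite ℤ A] [Module.Finite ℤ B] (φ : A →ₗ[ℤ] B)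
    (hφ : Function.Injective φ) (h : Module.finrank ℤ A = Module.finrank ℤ B)
    (hsat : ∀ (m : ℤ), m ≠ 0 → ∀ w, m • w ∈ LinearMap.range φ → w ∈ LinearMap.range φ) :
    Function.Surjective φ := by
  have h1 := LinearMap.finrank_range_of_inj hφ
  have h2 := (LinearMap.range φ).finrank_quotient_add_finrank
  have h3 : Module.finrank ℤ (B ⧸ LinearMap.range φ) = 0 := by omega
  intro b
  -- A quotient of rank zero is torsion, so a nonzero multiple of `b` lies in the range.
  obtain ⟨m, hm, hb⟩ := Module.finrank_eq_zero_iff.1 h3 (Submodule.Quotient.mk b)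
  rw [← Submodule.Quotient.mk_smul, Submodule.Quotient.mk_eq_zero] at hb
  exact hsat m hm b hb

/-! ### Degree functions and condensed functors -/

namespace GradedPoset

variable {P : Type u} [PartialOrder P] {deg : P → ℕ}

/-- Finiteness of the up-set provides a cover `p ⋖ c` with `c ≤ q`; the degree drops by one at `c`
and does not rise afterwards. -/
lemma IsDegreeFunction.lt (hdeg : IsDegreeFunction deg) (hfin : ∀ p₀ : P, (Set.Ici p₀).Finite)
    {p q : P} (h : p < q) : deg q < deg p := by
  obtain ⟨c, hc⟩ := ((hfin p).subset (fun x hx => hx.1.le : Set.Ioc p q ⊆ _)).exists_minimal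
    ⟨q, h, le_rfl⟩
  have hcov : p ⋖ c := ⟨hc.prop.1, fun x hx hxc =>
    hxc.not_ge (hc.le_of_le ⟨hx, hxc.le.trans hc.prop.2⟩ hxc.le)⟩
  have := hdeg.deg_eq_of_covBy hcov
  have := hdeg.antitone hc.prop.2
  omega

lemma IsDegreeFunction.eq_of_le (hdeg : IsDegreeFunction deg)
    (hfin : ∀ p₀ : P, (Set.Ici p₀).Finite) {p q : P} (h : p ≤ q) (hd : deg p ≤ deg q) : p = q := by
  by_contra hne
  have := hdeg.lt hfin (lt_of_le_of_ne h hne)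
  omega

section Condensed

variable {n : ℕ} {F : P ⥤ AddCommGrpCat.{u}}

lemma mem_kerAt {p : P} {x : F.obj p} :
    x ∈ kerAt F p ↔ ∀ (q : P) (h : p < q), (F.map (homOfLE h.le)).hom x = 0 := by
  simp [kerAt, AddSubgroup.mem_iInf]

lemma IsCondensed.kerAt_eq_top (hF : IsCondensed deg n F) (hdeg : IsDegreeFunction deg)
    (hfin : ∀ p₀ : P, (Set.Ici p₀).Finite) {p : P} (hp : deg p = n) : kerAt F p = ⊤ := by
  rw [eq_top_iff]
  intro x _
  rw [mem_kerAt]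
  intro q hq
  have := hF.zero_of_lt q (hp ▸ hdeg.lt hfin hq)
  exact Subsingleton.elim _ _

lemma IsCondensed.coe_tau (hF : IsCondensed deg n F) (hdeg : IsDegreeFunction deg)
    (hfin : ∀ p₀ : P, (Set.Ici p₀).Finite) {p : P} (hp : deg p = n) (x : F.obj p) :
    (tau deg n F p x : F.obj p) = x := by
  rw [tau, dif_pos ⟨hp, hF.kerAt_eq_top hdeg hfin hp⟩]
  rfl

lemma IsCondensed.subsingleton_kerAt (hF : IsCondensed deg n F) {p : P} (hp : deg p ≠ n) :
    Subsingleton (kerAt F p) := by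
  rcases lt_or_gt_of_ne hp with h | h
  · have := hF.zero_of_lt p h
    infer_instance
  · rw [hF.ker_eq_bot p h]
    infer_instance

/-- Elements of an `n`-condensed functor are detected in degree `n`. -/
lemma IsCondensed.eq_zero (hF : IsCondensed deg n F) (hdeg : IsDegreeFunction deg)
    (hfin : ∀ p₀ : P, (Set.Ici p₀).Finite) {p : P} (x : F.obj p)
    (hx : ∀ (q : P) (h : p ≤ q), deg q = n → (F.map (homOfLE h)).hom x = 0) : x = 0 := by
  induction hk : deg p using Nat.strong_induction_on generalizing p with
  | _ k ih =>
    rcases lt_trichotomy (deg p) n with h | h | h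
    · have := hF.zero_of_lt p h
      exact Subsingleton.elim _ _
    · have := hx p le_rfl h
      rwa [show homOfLE (le_refl p) = 𝟙 p from rfl, F.map_id] at this
    -- Above degree `n`, all proper restrictions of `x` vanish by induction, and `Ker_F(p)` is
    -- trivial.
    · suffices x ∈ kerAt F p by
        rw [hF.ker_eq_bot p h] at this
        exact this
      rw [mem_kerAt]
      intro q hq
      refine ih (deg q) (hk ▸ hdeg.lt hfin hq) _ ?_ rfl
      intro r hr hrn
      rw [← AddCommGrpCat.comp_apply, ← F.map_comp]
      exact hx r _ hrn

/-- The component of `lam` at an object. -/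
noncomputable def lamAt (deg : P → ℕ) (n : ℕ) (F : P ⥤ AddCommGrpCat.{u}) (q : P) :
    F.obj q →+ ∀ p : Set.Ici q, kerAt F p := ((lam deg n F).app q).hom

lemma lamAt_apply (q : P) (x : F.obj q) (p : Set.Ici q) :
    lamAt deg n F q x p = tau deg n F p ((F.map (homOfLE p.2)).hom x) := rfl

lemma IsCondensed.coe_lamAt (hF : IsCondensed deg n F) (hdeg : IsDegreeFunction deg)
    (hfin : ∀ p₀ : P, (Set.Ici p₀).Finite) {q : P} (x : F.obj q) (p : Set.Ici q)
    (hp : deg p = n) : (lamAt deg n F q x p : F.obj p) = (F.map (homOfLE p.2)).hom x := by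
  rw [lamAt_apply, hF.coe_tau hdeg hfin hp]

lemma IsCondensed.lamAt_injective (hF : IsCondensed deg n F) (hdeg : IsDegreeFunction deg)
    (hfin : ∀ p₀ : P, (Set.Ici p₀).Finite) (q : P) : Function.Injective (lamAt deg n F q) := by
  rw [injective_iff_map_eq_zero]
  intro x hx
  refine hF.eq_zero hdeg hfin x fun p hp hpn => ?_
  rw [← hF.coe_lamAt hdeg hfin x ⟨p, hp⟩ hpn, hx]
  rfl

lemma IsCondensed.mono_lam (hF : IsCondensed deg n F) (hdeg : IsDegreeFunction deg)
    (hfin : ∀ p₀ : P, (Set.Ici p₀).Finite) : Mono (lam deg n F) := by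
  have : ∀ q, Mono ((lam deg n F).app q) := fun q =>
    (AddCommGrpCat.mono_iff_injective _).2 (hF.lamAt_injective hdeg hfin q)
  exact NatTrans.mono_of_mono_app _

end Condensed

/-! ### Objectwise exactness of the defining sequences -/

section Seq

variable (deg) (n : ℕ)

/-- The component of `proj` at an object. -/
noncomputable def projAt (q : P) :
    (∀ p : Set.Ici q, kerAt (seq deg n) p) →+ (seq deg (n + 1)).obj q := ((proj deg n).app q).hom

lemma exact_seqShortComplex : (seqShortComplex deg n).Exact :=
  ShortComplex.exact_cokernel (lam deg n (seq deg n))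

instance : Epi (proj deg n) := inferInstanceAs (Epi (cokernel.π _))

lemma projAt_surjective (q : P) : Function.Surjective (projAt deg n q) :=
  (AddCommGrpCat.epi_iff_surjective ((proj deg n).app q)).1 inferInstance

lemma projAt_eq_zero_iff (q : P) (y : ∀ p : Set.Ici q, kerAt (seq deg n) p) :
    projAt deg n q y = 0 ↔ ∃ x, lamAt deg n (seq deg n) q x = y := by
  have := (exact_seqShortComplex deg n).map ((evaluation P AddCommGrpCat.{u}).obj q)
  rw [ShortComplex.ab_exact_iff_function_exact] at this
  exact this y

lemma projAt_naturality {r q : P} (h : r ≤ q) (y : ∀ p : Set.Ici r, kerAt (seq deg n) p) :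
    ((seq deg (n + 1)).map (homOfLE h)).hom (projAt deg n r y) =
      projAt deg n q (fun p => y ⟨p.1, h.trans p.2⟩) := by
  change ((proj deg n).app r ≫ (seq deg (n + 1)).map (homOfLE h)).hom y = _
  rw [← (proj deg n).naturality]
  rfl

variable {deg n}

lemma shortExact_seqShortComplex (hdeg : IsDegreeFunction deg)
    (hfin : ∀ p₀ : P, (Set.Ici p₀).Finite) (hF : IsCondensed deg n (seq deg n)) :
    (seqShortComplex deg n).ShortExact where
  exact := exact_seqShortComplex deg n
  mono_f := hF.mono_lam hdeg hfin
  epi_g := inferInstanceAs (Epi (proj deg n))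

end Seq

end GradedPoset

/-! ### Normal forms, ranks and the inductive step -/

namespace GradedPoset

variable {P : Type u} [PartialOrder P] {deg : P → ℕ} {n : ℕ} {J : P → ℕ → Set P}

/-- `F` is `n`-condensed, its values are free of rank `R n`, and `F(p)` is the product of the
groups `F(q)` for `q ∈ J p n` as soon as `n < deg p`. -/
structure IsFreeCondensed (deg : P → ℕ) (J : P → ℕ → Set P) (n : ℕ)
    (F : P ⥤ AddCommGrpCat.{u}) : Prop where
  condensed : IsCondensed deg n F
  free : ∀ p, Module.Free ℤ (F.obj p)
  finite : ∀ p, Module.Finite ℤ (F.obj p)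
  finrank_eq : ∀ p, n ≤ deg p → (Module.finrank ℤ (F.obj p) : ℤ) = R deg n p
  eq_zero : ∀ p, n < deg p → ∀ x : F.obj p,
    (∀ q ∈ J p n, ∀ h : p ≤ q, (F.map (homOfLE h)).hom x = 0) → x = 0
  exists_eq : ∀ p, n < deg p → ∀ y : ∀ q, F.obj q,
    ∃ x : F.obj p, ∀ q ∈ J p n, ∀ h : p ≤ q, (F.map (homOfLE h)).hom x = y q

/-- Since `R 0` is constantly 1, the rank condition in degree 0 counts the elements of `J p 0`. -/
lemma exists_J_zero_eq_singleton (hfin : ∀ p₀ : P, (Set.Ici p₀).Finite)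
    (hJ : IsLocalCoveringFamily deg J) (hA : IsAdequate deg J) {p : P} (hp : 0 < deg p) :
    ∃ q, J p 0 = {q} := by
  have h := hA.rank_eq 0 p hp
  have hf : (J p 0).Finite := (hfin p).subset fun q hq => (hJ.subset p 0 hp.le hq).1
  simp only [R] at h
  rw [finsum_mem_eq_finite_toFinset_sum _ hf] at h
  simp only [Finset.sum_const, mul_one, nsmul_eq_mul] at h
  rw [← Set.ncard_eq_one, Set.ncard_eq_toFinset_card _ hf]
  exact_mod_cast h.symm

lemma isFreeCondensed_seq_zero (hfin : ∀ p₀ : P, (Set.Ici p₀).Finite)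
    (hJ : IsLocalCoveringFamily deg J) (hA : IsAdequate deg J) :
    IsFreeCondensed deg J 0 (seq deg 0) where
  condensed :=
    { zero_of_lt := fun p h => absurd h (Nat.not_lt_zero _)
      ker_eq_bot := fun p hp => by
        obtain ⟨q, hq⟩ := exists_J_zero_eq_singleton hfin hJ hA hp
        obtain ⟨hpq, hq0⟩ := hJ.subset p 0 hp.le (hq ▸ Set.mem_singleton q : q ∈ J p 0)
        have hlt : p < q := lt_of_le_of_ne hpq (by rintro rfl; omega)
        rw [eq_bot_iff]
        intro x hx
        -- The transition maps of `constZ P` are identities, so one strict inequality suffices to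
        -- kill `x`.
        exact mem_kerAt.1 hx q hlt }
  free := fun p => Module.Free.of_equiv (ULift.moduleEquiv : ULift.{u} ℤ ≃ₗ[ℤ] ℤ).symm
  finite := fun p => Module.Finite.equiv (ULift.moduleEquiv : ULift.{u} ℤ ≃ₗ[ℤ] ℤ).symm
  finrank_eq := fun p _ => by
    have := (ULift.moduleEquiv : ULift.{u} ℤ ≃ₗ[ℤ] ℤ).finrank_eq
    rw [Module.finrank_self] at this
    exact congrArg (Nat.cast : ℕ → ℤ) this
  eq_zero := fun p hp x hx => by
    obtain ⟨q, hq⟩ := exists_J_zero_eq_singleton hfin hJ hA hp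
    have hqJ : q ∈ J p 0 := hq ▸ Set.mem_singleton q
    exact hx q hqJ (hJ.subset p 0 hp.le hqJ).1
  exists_eq := fun p hp y => by
    obtain ⟨q, hq⟩ := exists_J_zero_eq_singleton hfin hJ hA hp
    refine ⟨y q, fun r hr _ => ?_⟩
    rw [hq] at hr
    obtain rfl : r = q := hr
    rfl

section Step

variable (hdeg : IsDegreeFunction deg) (hfin : ∀ p₀ : P, (Set.Ici p₀).Finite)
  (hJ : IsLocalCoveringFamily deg J) (hA : IsAdequate deg J)
  (hF : IsFreeCondensed deg J n (seq deg n))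

/-- The families in `∏_{p ≥ p₀} Ker_{F_n}(p)` that vanish on `J p₀ n`. -/
def normalForms (deg : P → ℕ) (J : P → ℕ → Set P) (n : ℕ) (p₀ : P) :
    Submodule ℤ (∀ p : Set.Ici p₀, kerAt (seq deg n) p) where
  carrier := {y | ∀ p : Set.Ici p₀, p.1 ∈ J p₀ n → y p = 0}
  add_mem' := fun ha hb p hp => by simp [ha p hp, hb p hp]
  zero_mem' := fun _ _ => rfl
  smul_mem' := fun c x hx p hp => by simp [hx p hp]

include hdeg hfin hJ hF in
lemma exists_normalForm {p₀ : P} (hp : n < deg p₀) (z : (seq deg (n + 1)).obj p₀) :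
    ∃ y ∈ normalForms deg J n p₀, projAt deg n p₀ y = z := by
  obtain ⟨y, rfl⟩ := projAt_surjective deg n p₀ z
  classical
  -- `x` takes the values of `y` on `J p₀ n`, so subtracting its image under `λ` clears these
  -- coordinates without changing the class. The default 0 is never read there.
  obtain ⟨x, hx⟩ := hF.exists_eq p₀ hp fun q => if h : p₀ ≤ q then (y ⟨q, h⟩ : (seq deg n).obj q)
    else 0
  refine ⟨y - lamAt deg n _ p₀ x, fun p hpJ => ?_, ?_⟩
  · rw [Pi.sub_apply, sub_eq_zero, Subtype.ext_iff, hF.condensed.coe_lamAt hdeg hfin _ _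
      (hJ.subset p₀ n hp.le hpJ).2, hx _ hpJ p.2, dif_pos (show p₀ ≤ p.1 from p.2)]
  · rw [map_sub, sub_eq_self, projAt_eq_zero_iff]
    exact ⟨x, rfl⟩

include hdeg hfin hJ hF in
-- This is uniqueness of normal forms: the kernel of the projection is the image of `λ`, and an
-- element of `F_n(p₀)` vanishing on `J p₀ n` is zero.
lemma normalForm_eq_zero {p₀ : P} (hp : n < deg p₀)
    {y : ∀ p : Set.Ici p₀, kerAt (seq deg n) p} (hy : y ∈ normalForms deg J n p₀)
    (h0 : projAt deg n p₀ y = 0) : y = 0 := by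
  obtain ⟨x, rfl⟩ := (projAt_eq_zero_iff deg n p₀ y).1 h0
  rw [hF.eq_zero p₀ hp x fun q hq h => ?_, map_zero]
  rw [← hF.condensed.coe_lamAt hdeg hfin x ⟨q, h⟩ (hJ.subset p₀ n hp.le hq).2, hy ⟨q, h⟩ hq]
  rfl

include hF in
lemma free_finite_kerAt (p : P) :
    Module.Free ℤ (kerAt (seq deg n) p) ∧ Module.Finite ℤ (kerAt (seq deg n) p) := by
  have := hF.free p
  have := hF.finite p
  exact ⟨inferInstanceAs (Module.Free ℤ (AddSubgroup.toIntSubmodule (kerAt (seq deg n) p))),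
    inferInstanceAs (Module.Finite ℤ (AddSubgroup.toIntSubmodule (kerAt (seq deg n) p)))⟩

include hdeg in
-- In degrees at most `n`, the only factor of `Ker'_{F_n}(p)` that can be nonzero is the one at `p`
-- itself, so `λ` is onto.
lemma IsCondensed.subsingleton_seq_succ (hfin : ∀ p₀ : P, (Set.Ici p₀).Finite)
    (hF : IsCondensed deg n (seq deg n)) {p : P} (hp : deg p < n + 1) :
    Subsingleton ((seq deg (n + 1)).obj p) := by
  refine subsingleton_of_forall_eq 0 fun z => ?_
  obtain ⟨y, rfl⟩ := projAt_surjective deg n p z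
  rw [projAt_eq_zero_iff]
  refine ⟨y ⟨p, le_rfl⟩, funext fun q => ?_⟩
  by_cases hq : deg q = n
  · obtain ⟨q, hpq⟩ := q
    obtain rfl : p = q := hdeg.eq_of_le hfin hpq (by change deg q = n at hq; omega)
    rw [Subtype.ext_iff, hF.coe_lamAt hdeg hfin _ _ hq]
    change ((seq deg n).map (𝟙 p)).hom _ = _
    rw [(seq deg n).map_id]
    rfl
  · have := hF.subsingleton_kerAt hq
    exact Subsingleton.elim _ _

include hdeg hfin hJ hF in
-- When `deg p > n`, the projection maps the normal forms, a subgroup of a finitely generated free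
-- group, isomorphically onto `F_{n+1}(p)`.
lemma free_finite_seq_succ (p : P) : Module.Free ℤ ((seq deg (n + 1)).obj p) ∧
    Module.Finite ℤ ((seq deg (n + 1)).obj p) := by
  rcases lt_or_ge n (deg p) with hp | hp
  · have : Finite (Set.Ici p) := hfin p
    have := fun q => (free_finite_kerAt hF q).1
    have := fun q => (free_finite_kerAt hF q).2
    let φ := (projAt deg n p).toIntLinearMap.comp (normalForms deg J n p).subtype
    have hφ : Function.Bijective φ := by
      constructor
      · rw [injective_iff_map_eq_zero]
        rintro ⟨y, hy⟩ h0
        exact Subtype.ext (normalForm_eq_zero hdeg hfin hJ hF hp hy h0)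
      · intro z
        obtain ⟨y, hy, rfl⟩ := exists_normalForm hdeg hfin hJ hF hp z
        exact ⟨⟨y, hy⟩, rfl⟩
    let e := LinearEquiv.ofBijective φ hφ
    exact ⟨Module.Free.of_equiv e, Module.Finite.equiv e⟩
  · have := hF.condensed.subsingleton_seq_succ hdeg hfin (Nat.lt_succ_of_le hp)
    exact ⟨inferInstance, inferInstance⟩

include hdeg hfin hF in
-- Ranks add up along `0 ⟶ F_n(p) ⟶ Ker'_{F_n}(p) ⟶ F_{n+1}(p) ⟶ 0`, and only the factors of degree
-- `n`, where `Ker_{F_n} = F_n`, contribute to the middle term.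
lemma finrank_seq_succ {p : P} (hp : n ≤ deg p) :
    (Module.finrank ℤ ((seq deg (n + 1)).obj p) : ℤ) = R deg (n + 1) p := by
  have : Finite (Set.Ici p) := hfin p
  have : Fintype (Set.Ici p) := Fintype.ofFinite _
  have := fun q => (free_finite_kerAt hF q).1
  have := fun q => (free_finite_kerAt hF q).2
  have := hF.finite p
  have h1 := (LinearMap.ker (projAt deg n p).toIntLinearMap).finrank_quotient_add_finrank
  rw [((projAt deg n p).toIntLinearMap.quotKerEquivOfSurjective
    (projAt_surjective deg n p)).finrank_eq] at h1
  have h2 : LinearMap.ker (projAt deg n p).toIntLinearMap =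
      LinearMap.range (lamAt deg n (seq deg n) p).toIntLinearMap := by
    ext y
    exact projAt_eq_zero_iff deg n p y
  rw [h2, LinearMap.finrank_range_of_inj (hF.condensed.lamAt_injective hdeg hfin p),
    Module.finrank_pi_fintype] at h1
  classical
  have h3 : (Module.finrank ℤ ((seq deg (n + 1)).obj p) : ℤ) +
      Module.finrank ℤ ((seq deg n).obj p) = _ := congrArg (Nat.cast : ℕ → ℤ) h1
  rw [R, ← hF.finrank_eq p hp, eq_sub_iff_add_eq, h3]
  have hset : aboveOfDeg deg p n ⊆ Set.Ici p := fun q hq => hq.1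
  rw [Nat.cast_sum, finsum_mem_eq_finite_toFinset_sum _ ((hfin p).subset hset)]
  rw [← finsum_eq_sum_of_fintype, finsum_set_coe_eq_finsum_mem (Set.Ici p)
    (f := fun q => (Module.finrank ℤ (kerAt (seq deg n) q) : ℤ)),
    finsum_mem_eq_finite_toFinset_sum _ (hfin p)]
  symm
  refine Finset.sum_subset_zero_on_sdiff (by simpa using hset) ?_ ?_
  · intro q hq
    simp only [Finset.mem_sdiff, Set.Finite.mem_toFinset] at hq
    have := hF.condensed.subsingleton_kerAt (p := q) fun h => hq.2 ⟨hq.1, h⟩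
    exact_mod_cast Module.finrank_zero_of_subsingleton
  · intro q hq
    obtain ⟨-, hqn⟩ : q ∈ aboveOfDeg deg p n := by simpa using hq
    rw [← hF.finrank_eq q hqn.ge]
    have : AddSubgroup.toIntSubmodule (kerAt (seq deg n) q) = ⊤ := by
      rw [hF.condensed.kerAt_eq_top hdeg hfin hqn]; rfl
    have h4 := (LinearEquiv.ofTop _ this).finrank_eq
    exact congrArg _ h4.symm

include hJ in
/-- A normal form at `p₀` restricts to normal forms at the elements of `J p₀ (n + 1)`. -/
lemma restrict_mem_normalForms {p₀ q : P} (hp : n < deg p₀) (hq : q ∈ J p₀ (n + 1)) (h : p₀ ≤ q)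
    {y : ∀ p : Set.Ici p₀, kerAt (seq deg n) p} (hy : y ∈ normalForms deg J n p₀) :
    (fun p : Set.Ici q => y ⟨p.1, h.trans p.2⟩) ∈ normalForms deg J n q :=
  fun p hpJ => hy ⟨p.1, h.trans p.2⟩ (hJ.mono p₀ n hp q hq hpJ)

include hJ in
lemma exists_mem_J_le {p₀ p : P} (hp : n < deg p₀) (h : p₀ ≤ p) (hpn : deg p = n) :
    ∃ q ∈ J p₀ (n + 1), p₀ ≤ q ∧ q ≤ p ∧ deg q = n + 1 := by
  have : p ∈ ⋃ q ∈ J p₀ (n + 1), aboveOfDeg deg q n := by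
    rw [hJ.cover p₀ n hp]
    exact ⟨h, hpn⟩
  simp only [Set.mem_iUnion] at this
  obtain ⟨q, hq, hqp, -⟩ := this
  obtain ⟨h1, h2⟩ := hJ.subset p₀ (n + 1) hp hq
  exact ⟨q, hq, h1, hqp, h2⟩

include hdeg hfin hJ hF in
-- The normal form of `z` restricts to a normal form of 0 at each `q ∈ J p₀ (n + 1)`, which is zero
-- by uniqueness; by the covering condition every coordinate of degree `n` occurs in such a
-- restriction.
lemma seq_succ_eq_zero {p₀ : P} (hp : n + 1 < deg p₀) (z : (seq deg (n + 1)).obj p₀)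
    (hz : ∀ q ∈ J p₀ (n + 1), ∀ h : p₀ ≤ q, ((seq deg (n + 1)).map (homOfLE h)).hom z = 0) :
    z = 0 := by
  have hp' : n < deg p₀ := by omega
  obtain ⟨y, hy, rfl⟩ := exists_normalForm hdeg hfin hJ hF hp' z
  suffices y = 0 by rw [this, map_zero]
  funext p
  by_cases hpn : deg p = n
  · obtain ⟨q, hqJ, hpq, hqp, hqn⟩ := exists_mem_J_le hJ hp' p.2 hpn
    have h0 := hz q hqJ hpq
    rw [projAt_naturality] at h0
    have := normalForm_eq_zero hdeg hfin hJ hF (by omega)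
      (restrict_mem_normalForms hJ hp' hqJ hpq hy) h0
    exact congrFun this ⟨p.1, hqp⟩
  · have := hF.condensed.subsingleton_kerAt hpn
    exact Subsingleton.elim _ _

include hdeg hfin hJ hF in
-- This is the saturation needed for surjectivity. By uniqueness, the normal form of `z` restricts
-- at `q` to `m` times that of `w q`; by covering, all its coordinates are divisible by `m`.
lemma exists_restrict_eq_of_smul {p₀ : P} (hp : n + 1 < deg p₀) {m : ℤ} (hm : m ≠ 0)
    (w : ∀ q, (seq deg (n + 1)).obj q) (z : (seq deg (n + 1)).obj p₀)
    (hz : ∀ q ∈ J p₀ (n + 1), ∀ h : p₀ ≤ q,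
      ((seq deg (n + 1)).map (homOfLE h)).hom z = m • w q) :
    ∃ z' : (seq deg (n + 1)).obj p₀, ∀ q ∈ J p₀ (n + 1), ∀ h : p₀ ≤ q,
      ((seq deg (n + 1)).map (homOfLE h)).hom z' = w q := by
  have hp' : n < deg p₀ := by omega
  have := fun q => (free_finite_kerAt hF q).1
  have inj : ∀ p (a b : kerAt (seq deg n) p), m • a = m • b → a = b := fun p a b h =>
    smul_right_injective _ hm h
  obtain ⟨y, hy, rfl⟩ := exists_normalForm hdeg hfin hJ hF hp' z
  have key : ∀ q ∈ J p₀ (n + 1), ∀ h : p₀ ≤ q, ∃ v ∈ normalForms deg J n q,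
      projAt deg n q v = w q ∧ (fun p : Set.Ici q => y ⟨p.1, h.trans p.2⟩) = m • v := by
    intro q hq h
    have hqn : n < deg q := by rw [(hJ.subset p₀ (n + 1) hp' hq).2]; omega
    obtain ⟨v, hv, hvw⟩ := exists_normalForm hdeg hfin hJ hF hqn (w q)
    refine ⟨v, hv, hvw, sub_eq_zero.1 (normalForm_eq_zero hdeg hfin hJ hF hqn
      (Submodule.sub_mem _ (restrict_mem_normalForms hJ hp' hq h hy)
        (Submodule.smul_mem _ m hv)) ?_)⟩
    rw [map_sub, map_zsmul, hvw, ← hz q hq h, projAt_naturality, sub_self]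
  have hdiv : ∀ p : Set.Ici p₀, ∃ a : kerAt (seq deg n) p, y p = m • a := by
    intro p
    by_cases hpn : deg p = n
    · obtain ⟨q, hqJ, hpq, hqp, -⟩ := exists_mem_J_le hJ hp' p.2 hpn
      obtain ⟨v, -, -, hv⟩ := key q hqJ hpq
      exact ⟨v ⟨p.1, hqp⟩, congrFun hv ⟨p.1, hqp⟩⟩
    · have := hF.condensed.subsingleton_kerAt hpn
      exact ⟨0, Subsingleton.elim _ _⟩
  choose a ha using hdiv
  -- Division by `m` is unambiguous in the torsion-free groups `Ker_{F_n}(p)`, so the quotient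
  -- family restricts to the chosen normal form of each `w q`.
  refine ⟨projAt deg n p₀ a, fun q hq h => ?_⟩
  obtain ⟨v, -, hvw, hv⟩ := key q hq h
  rw [projAt_naturality, ← hvw]
  congr 1
  funext p
  apply inj
  rw [← ha ⟨p.1, h.trans p.2⟩]
  exact congrFun hv p

include hdeg hfin hJ hA hF in
lemma isFreeCondensed_seq_succ : IsFreeCondensed deg J (n + 1) (seq deg (n + 1)) where
  condensed :=
    { zero_of_lt := fun p hp => hF.condensed.subsingleton_seq_succ hdeg hfin hp
      ker_eq_bot := fun p hp => by
        rw [eq_bot_iff]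
        intro x hx
        refine seq_succ_eq_zero hdeg hfin hJ hF hp x fun q hq h => ?_
        -- Elements of `J p (n + 1)` have degree `n + 1 < deg p`, so they lie strictly above `p`.
        refine mem_kerAt.1 hx q (lt_of_le_of_ne h ?_)
        rintro rfl
        have := (hJ.subset p (n + 1) hp.le hq).2
        omega }
  free := fun p => (free_finite_seq_succ hdeg hfin hJ hF p).1
  finite := fun p => (free_finite_seq_succ hdeg hfin hJ hF p).2
  finrank_eq := fun p hp => finrank_seq_succ hdeg hfin hF (Nat.le_of_succ_le hp)
  eq_zero := fun p hp x hx => seq_succ_eq_zero hdeg hfin hJ hF hp x hx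
  exists_eq := fun p hp y => by
    have hle : ∀ q : J p (n + 1), p ≤ q := fun q => (hJ.subset p (n + 1) hp.le q.2).1
    have hJf : (J p (n + 1)).Finite := (hfin p).subset fun q hq => (hJ.subset p _ hp.le hq).1
    have : Finite (J p (n + 1)) := hJf
    have : Fintype (J p (n + 1)) := Fintype.ofFinite _
    have := fun p => (free_finite_seq_succ hdeg hfin hJ hF p).1
    have := fun p => (free_finite_seq_succ hdeg hfin hJ hF p).2
    let φ : (seq deg (n + 1)).obj p →ₗ[ℤ] ∀ q : J p (n + 1), (seq deg (n + 1)).obj q.1 :=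
      LinearMap.pi fun q => ((seq deg (n + 1)).map (homOfLE (hle q))).hom.toIntLinearMap
    have hφ : Function.Surjective φ := by
      refine φ.surjective_of_finrank_eq_of_saturated ?_ ?_ ?_
      · rw [injective_iff_map_eq_zero]
        exact fun x hx => seq_succ_eq_zero hdeg hfin hJ hF hp x fun q hq _ => congrFun hx ⟨q, hq⟩
      · rw [Module.finrank_pi_fintype]
        have h1 := finrank_seq_succ hdeg hfin hF (p := p) (by omega)
        rw [hA.rank_eq (n + 1) p hp] at h1
        have h2 : ∀ q : J p (n + 1), R deg (n + 1) q =
            (Module.finrank ℤ ((seq deg (n + 1)).obj q.1) : ℤ) := fun q =>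
          (finrank_seq_succ hdeg hfin hF (by rw [(hJ.subset p (n + 1) hp.le q.2).2]; omega)).symm
        rw [← finsum_set_coe_eq_finsum_mem, finsum_congr h2, finsum_eq_sum_of_fintype,
          ← Nat.cast_sum] at h1
        exact_mod_cast h1
      · rintro m hm w ⟨z, hz⟩
        classical
        obtain ⟨z', hz'⟩ := exists_restrict_eq_of_smul hdeg hfin hJ hF hp hm
          (fun q => if h : q ∈ J p (n + 1) then w ⟨q, h⟩ else 0) z (fun q hq _ => by
            rw [dif_pos hq]
            exact congrFun hz ⟨q, hq⟩)
        refine ⟨z', funext fun q => ?_⟩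
        have := hz' q.1 q.2 (hle q)
        rwa [dif_pos q.2] at this
    obtain ⟨x, hx⟩ := hφ fun q => y q.1
    exact ⟨x, fun q hq _ => congrFun hx ⟨q, hq⟩⟩

end Step

lemma isFreeCondensed_seq (hdeg : IsDegreeFunction deg) (hfin : ∀ p₀ : P, (Set.Ici p₀).Finite)
    (hJ : IsLocalCoveringFamily deg J) (hA : IsAdequate deg J) (n : ℕ) :
    IsFreeCondensed deg J n (seq deg n) := by
  induction n with
  | zero => exact isFreeCondensed_seq_zero hfin hJ hA
  | succ n ih => exact isFreeCondensed_seq_succ hdeg hfin hJ hA ih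

/-- A product of values of `F_n` over the finitely many objects of degree `n`. -/
lemma free_finite_finrank_term
    (hF : IsFreeCondensed deg J n (seq deg n)) (hn : {p : P | deg p = n}.Finite) :
    Module.Free ℤ (term deg n) ∧ Module.Finite ℤ (term deg n) ∧
      (Module.finrank ℤ (term deg n) : ℤ) = ∑ᶠ p ∈ {p : P | deg p = n}, R deg n p := by
  have : Finite {p : P // deg p = n} := hn
  have : Fintype {p : P // deg p = n} := Fintype.ofFinite _
  have := hF.free
  have := hF.finite
  let e : (∀ p : {p : P // deg p = n}, (seq deg n).obj p.1) ≃ₗ[ℤ] term deg n :=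
    (AddEquiv.refl _).toIntLinearEquiv
  refine ⟨Module.Free.of_equiv e, Module.Finite.equiv e, ?_⟩
  rw [← e.finrank_eq, Module.finrank_pi_fintype, Nat.cast_sum, ← finsum_eq_sum_of_fintype,
    ← finsum_set_coe_eq_finsum_mem]
  exact finsum_congr fun p => hF.finrank_eq p.1 p.2.ge

end GradedPoset

/-! ### Dimension shifting and objectwise exactness -/

/-- Dimension shifting along short exact sequences `0 ⟶ F n ⟶ K n ⟶ F (n + 1) ⟶ 0` whose
middle terms are acyclic. -/
lemma CategoryTheory.Abelian.Ext.exists_dimensionShift {C : Type*} [Category* C] [Abelian C]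
    [HasExt.{u} C] (X : C) (k : ℕ) (F K : ℕ → C) (i : ∀ n, F n ⟶ K n) (π : ∀ n, K n ⟶ F (n + 1))
    (w : ∀ n, i n ≫ π n = 0) (hS : ∀ n, (ShortComplex.mk (i n) (π n) (w n)).ShortExact)
    (hK : ∀ n j, Subsingleton (Abelian.Ext.{u} X (K n) (j + 1))) :
    ∃ ψ : (X ⟶ F (k + 1)) →+ Abelian.Ext.{u} X (F 0) (k + 1), Function.Surjective ψ ∧
      ∀ f, ψ f = 0 ↔ ∃ g : X ⟶ K k, g ≫ π k = f := by
  induction k generalizing F K with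
  | zero =>
    refine ⟨((hS 0).extClass.postcomp X (zero_add 1)).comp
      Abelian.Ext.addEquiv₀.symm.toAddMonoidHom, fun y => ?_, fun f => ?_⟩
    · obtain ⟨x, hx⟩ := Abelian.Ext.covariant_sequence_exact₁ X (hS 0) y
        (Subsingleton.elim _ _) (zero_add 1)
      obtain ⟨f, rfl⟩ := Abelian.Ext.addEquiv₀.symm.surjective x
      exact ⟨f, hx⟩
    · constructor
      · intro h
        obtain ⟨x, hx⟩ := Abelian.Ext.covariant_sequence_exact₃ X (hS 0) (Abelian.Ext.mk₀ f)
          (zero_add 1) h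
        obtain ⟨g, rfl⟩ := Abelian.Ext.addEquiv₀.symm.surjective x
        refine ⟨g, ?_⟩
        erw [Abelian.Ext.mk₀_comp_mk₀] at hx
        exact Abelian.Ext.addEquiv₀.symm.injective hx
      · rintro ⟨g, rfl⟩
        change (Abelian.Ext.mk₀ (g ≫ π 0)).comp (hS 0).extClass (zero_add 1) = 0
        rw [← Abelian.Ext.mk₀_comp_mk₀]
        exact (Abelian.Ext.comp_assoc_of_second_deg_zero _ _ _ _).trans (by
          erw [(hS 0).comp_extClass]
          simp)
  | succ k ih =>
    obtain ⟨ψ, hψ, hψ'⟩ := ih (fun n => F (n + 1)) (fun n => K (n + 1)) (fun n => i (n + 1))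
      (fun n => π (n + 1)) (fun n => w _) (fun n => hS _) (fun n j => hK _ j)
    -- The shifted sequences reach `Ext(X, F 1)`; the remaining connecting map to `Ext(X, F 0)` is
    -- bijective, as both neighbouring `Ext(X, K 0)` groups vanish.
    refine ⟨((hS 0).extClass.postcomp X rfl).comp ψ, fun y => ?_, fun f => ?_⟩
    · have := hK 0 (k + 1)
      obtain ⟨x, rfl⟩ := Abelian.Ext.covariant_sequence_exact₁ X (hS 0) y
        (Subsingleton.elim _ _) rfl
      obtain ⟨f, rfl⟩ := hψ x
      exact ⟨f, rfl⟩
    · rw [← hψ', AddMonoidHom.comp_apply]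
      constructor
      · intro h
        obtain ⟨x, hx⟩ := Abelian.Ext.covariant_sequence_exact₃ X (hS 0) (ψ f) rfl h
        have := hK 0 k
        rw [← hx, Subsingleton.elim x 0, Abelian.Ext.zero_comp]
      · intro h
        rw [h, map_zero]

/-- Exactness of a short complex of functors can be checked objectwise. -/
lemma CategoryTheory.ShortComplex.exact_of_evaluation {J C : Type*} [Category* J] [Category* C]
    [Abelian C] (S : ShortComplex (J ⥤ C))
    (h : ∀ j, (S.map ((evaluation J C).obj j)).Exact) : S.Exact := by
  rw [ShortComplex.exact_iff_isZero_homology, Functor.isZero_iff]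
  intro j
  exact ((ShortComplex.exact_iff_isZero_homology _).1 (h j)).of_iso
    (S.mapHomologyIso ((evaluation J C).obj j)).symm

namespace GradedPoset

variable {P : Type u} [PartialOrder P]

/-! ### Limits as morphisms from the constant functor -/

section ConstZ

variable {F G : P ⥤ AddCommGrpCat.{u}}

/-- The morphism from the constant functor given by a compatible family of elements. -/
def sectionHom (s : ∀ p, F.obj p)
    (hs : ∀ p q (h : p ≤ q), (F.map (homOfLE h)).hom (s p) = s q) : constZ P ⟶ F where
  app p := AddCommGrpCat.ofHom
    ((zmultiplesHom (F.obj p) (s p)).comp (AddEquiv.ulift : ULift.{u} ℤ ≃+ ℤ).toAddMonoidHom)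
  naturality p q f := by
    ext x
    change x.down • s q = (F.map f).hom (x.down • s p)
    rw [map_zsmul, ← hs p q (leOfHom f)]
    rfl

/-- The elements of the values of `F` defined by a morphism from the constant functor. -/
def evalOne (F : P ⥤ AddCommGrpCat.{u}) (p : P) : (constZ P ⟶ F) →+ F.obj p :=
  AddMonoidHom.mk' (fun f => (f.app p).hom ⟨1⟩) fun _ _ => rfl

@[simp] lemma evalOne_sectionHom (s : ∀ p, F.obj p)
    (hs : ∀ p q (h : p ≤ q), (F.map (homOfLE h)).hom (s p) = s q) (p : P) :
    evalOne F p (sectionHom s hs) = s p :=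
  one_zsmul (s p)

lemma evalOne_comp (f : constZ P ⟶ F) (g : F ⟶ G) (p : P) :
    evalOne G p (f ≫ g) = (g.app p).hom (evalOne F p f) := rfl

lemma map_evalOne (f : constZ P ⟶ F) {p q : P} (h : p ≤ q) :
    (F.map (homOfLE h)).hom (evalOne F p f) = evalOne F q f := by
  change (f.app p ≫ F.map (homOfLE h)).hom ⟨1⟩ = _
  rw [← f.naturality]
  rfl

lemma addMonoidHom_ulift_ext {A : Type*} [AddCommGroup A] {f g : ULift.{u} ℤ →+ A}
    (h : f ⟨1⟩ = g ⟨1⟩) : f = g := by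
  ext ⟨x⟩
  have : (⟨x⟩ : ULift.{u} ℤ) = x • ⟨1⟩ := by
    apply ULift.ext
    simp
  rw [this, map_zsmul, map_zsmul, h]

lemma constZ_hom_ext {f g : constZ P ⟶ F} (h : ∀ p, evalOne F p f = evalOne F p g) : f = g := by
  ext p : 2
  exact AddCommGrpCat.hom_ext (addMonoidHom_ulift_ext (h p))

instance : (Functor.const P : AddCommGrpCat.{u} ⥤ (P ⥤ AddCommGrpCat.{u})).Additive where
  map_add {_ _ _ _} := rfl

/-- Evaluation of maps from `ℤ` at `1`. -/
def uliftIntHomEquiv (A : AddCommGrpCat.{u}) : (AddCommGrpCat.of (ULift.{u} ℤ) ⟶ A) ≃+ A where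
  toFun f := f.hom ⟨1⟩
  invFun a := AddCommGrpCat.ofHom
    ((zmultiplesHom A a).comp (AddEquiv.ulift : ULift.{u} ℤ ≃+ ℤ).toAddMonoidHom)
  left_inv _ := AddCommGrpCat.hom_ext (addMonoidHom_ulift_ext (one_zsmul _))
  right_inv a := one_zsmul a
  map_add' _ _ := rfl

/-- Morphisms from the constant functor are elements of the limit. -/
noncomputable def homLimEquiv (F : P ⥤ AddCommGrpCat.{u}) :
    (constZ P ⟶ F) ≃+ (lim : (P ⥤ AddCommGrpCat.{u}) ⥤ AddCommGrpCat.{u}).obj F :=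
  (constLimAdj.homAddEquiv _ F).trans (uliftIntHomEquiv _)

lemma homLimEquiv_comp (f : constZ P ⟶ F) (g : F ⟶ G) :
    homLimEquiv G (f ≫ g) = (lim.map g).hom (homLimEquiv F f) := by
  exact congrArg (fun t => t.hom ⟨1⟩) (constLimAdj.homEquiv_naturality_right f g)

end ConstZ

/-! ### Acyclicity of coinduced functors -/

section Coinduced

variable {A B : P → Type u} [∀ p, AddCommGroup (A p)] [∀ p, AddCommGroup (B p)]

/-- `coinduced` is right adjoint to the forgetful functor: the morphism `F ⟶ coinduced A` given
by a family of maps `F(p) → A p`. -/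
def toCoinduced {F : P ⥤ AddCommGrpCat.{u}} (h : ∀ p, F.obj p →+ A p) : F ⟶ coinduced A where
  app q := AddCommGrpCat.ofHom
    (AddMonoidHom.pi fun p : Set.Ici q => (h p).comp (F.map (homOfLE p.2)).hom)
  naturality q r f := by
    ext x
    funext p
    change h p ((F.map (homOfLE p.2)).hom ((F.map f).hom x)) = h p ((F.map (homOfLE _)).hom x)
    rw [← AddCommGrpCat.comp_apply, ← F.map_comp]
    rfl

lemma toCoinduced_ext {F : P ⥤ AddCommGrpCat.{u}} {f g : F ⟶ coinduced A}
    (h : ∀ p x, (f.app p).hom x ⟨p, le_rfl⟩ = (g.app p).hom x ⟨p, le_rfl⟩) : f = g := by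
  ext q x
  funext p
  have hf : ∀ f : F ⟶ coinduced A, (f.app q).hom x p =
      (f.app p).hom ((F.map (homOfLE p.2)).hom x) ⟨p, le_rfl⟩ := fun f =>
    (congrFun (congrArg (fun t => t.hom x) (f.naturality (homOfLE p.2))) ⟨p, le_rfl⟩).symm
  exact (hf f).trans ((h _ _).trans (hf g).symm)

/-- Coinduction is right adjoint to taking the family of values, which preserves monomorphisms.
Concretely, one extends the diagonal coordinate at each `p` separately. -/
lemma injective_coinduced (hA : ∀ p, Injective (AddCommGrpCat.of (A p))) :
    Injective (coinduced A) where
  factors {X Y} g f _ := by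
    have hf : ∀ p, Mono (f.app p) := fun p => inferInstance
    let gp : ∀ p, X.obj p ⟶ AddCommGrpCat.of (A p) := fun p =>
      g.app p ≫ AddCommGrpCat.ofHom (Pi.evalAddMonoidHom (fun q : Set.Ici p => A q) ⟨p, le_rfl⟩)
    refine ⟨toCoinduced fun p => (Injective.factorThru (gp p) (f.app p)).hom, ?_⟩
    refine toCoinduced_ext fun p x => ?_
    change (f.app p ≫ Y.map (𝟙 p) ≫ Injective.factorThru (gp p) (f.app p)).hom x = _
    rw [Y.map_id, Category.id_comp, Injective.comp_factorThru]
    rfl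

/-- The functoriality of `coinduced`. -/
def coinducedMap (h : ∀ p, A p →+ B p) : coinduced A ⟶ coinduced B where
  app q := AddCommGrpCat.ofHom
    (AddMonoidHom.mk' (fun (x : ∀ p : Set.Ici q, A p) (p : Set.Ici q) => h p (x p))
      (fun x y => funext fun p => map_add (h p) (x p) (y p)))
  naturality _ _ _ := rfl

lemma shortExact_coinduced {C : P → Type u} [∀ p, AddCommGroup (C p)] (f : ∀ p, A p →+ B p)
    (g : ∀ p, B p →+ C p) (hf : ∀ p, Function.Injective (f p))
    (hg : ∀ p, Function.Surjective (g p)) (hfg : ∀ p, Function.Exact (f p) (g p))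
    (w : coinducedMap f ≫ coinducedMap g = 0) :
    (ShortComplex.mk (coinducedMap f) (coinducedMap g) w).ShortExact where
  exact := by
    refine ShortComplex.exact_of_evaluation _ fun q => ?_
    rw [ShortComplex.ab_exact_iff]
    intro (y : ∀ p : Set.Ici q, B p) hy
    have : ∀ p : Set.Ici q, ∃ x, f p x = y p := fun p => (hfg p (y p)).1 (congrFun hy p)
    choose x hx using this
    exact ⟨x, funext hx⟩
  mono_f := by
    have : ∀ q, Mono ((coinducedMap f).app q) := fun q =>
      (AddCommGrpCat.mono_iff_injective _).2 fun x y h =>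
        funext fun p => hf p (congrFun h p)
    exact NatTrans.mono_of_mono_app _
  epi_g := by
    have : ∀ q, Epi ((coinducedMap g).app q) := fun q =>
      (AddCommGrpCat.epi_iff_surjective _).2 fun (y : ∀ p : Set.Ici q, C p) => by
        choose x hx using fun p : Set.Ici q => hg p (y p)
        exact ⟨x, funext hx⟩
    exact NatTrans.epi_of_epi_app _

/-- The limit of `coinduced B` is the full product of the `B p`, without compatibility conditions,
so sections lift one coordinate at a time. -/
lemma hom_constZ_coinduced_surjective (g : ∀ p, A p →+ B p)
    (hg : ∀ p, Function.Surjective (g p)) (f : constZ P ⟶ coinduced B) :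
    ∃ f' : constZ P ⟶ coinduced A, f' ≫ coinducedMap g = f := by
  choose s hs using fun p => hg p (evalOne (coinduced B) p f ⟨p, le_rfl⟩)
  refine ⟨sectionHom (F := coinduced A) (fun q (p : Set.Ici q) => s p) (fun _ _ _ => rfl), ?_⟩
  refine constZ_hom_ext fun q => ?_
  rw [evalOne_comp]
  erw [evalOne_sectionHom]
  funext p
  refine (hs p).trans ?_
  rw [← map_evalOne f p.2]
  rfl

instance hasExt_functor : HasExt.{u} (P ⥤ AddCommGrpCat.{u}) := hasExt_of_enoughInjectives _

lemma exists_injective_coinduced_shortExact (A : P → Type u) [∀ p, AddCommGroup (A p)] :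
    ∃ (B C : P → AddCommGrpCat.{u}) (f : ∀ p, A p →+ B p) (g : ∀ p, B p →+ C p)
      (w : coinducedMap f ≫ coinducedMap g = 0), Injective (coinduced fun p => B p) ∧
        (∀ p, Function.Surjective (g p)) ∧
        (ShortComplex.mk (coinducedMap f) (coinducedMap g) w).ShortExact := by
  let B : P → AddCommGrpCat.{u} := fun p => Injective.under (AddCommGrpCat.of (A p))
  let f : ∀ p, A p →+ B p := fun p => (Injective.ι (AddCommGrpCat.of (A p))).hom
  let g : ∀ p, B p →+ AddCommGrpCat.of (B p ⧸ (f p).range) := fun p =>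
    QuotientAddGroup.mk' (f p).range
  have hfg : ∀ p, Function.Exact (f p) (g p) := fun p x =>
    (QuotientAddGroup.eq_zero_iff (N := (f p).range) x)
  have w : coinducedMap f ≫ coinducedMap g = 0 := by
    ext q x
    funext p
    exact (hfg p _).2 ⟨_, rfl⟩
  refine ⟨B, _, f, g, w, injective_coinduced fun p => ?_,
    fun p => QuotientAddGroup.mk'_surjective _,
    shortExact_coinduced f g (fun p => ?_) (fun p => QuotientAddGroup.mk'_surjective _) hfg w⟩
  · exact inferInstanceAs (Injective (Injective.under (AddCommGrpCat.of (A p))))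
  · exact (AddCommGrpCat.mono_iff_injective (Injective.ι (AddCommGrpCat.of (A p)))).1 inferInstance

/-- Embed each `A p` in an injective group. A class in `Ext^1` comes from a section of the coinduced
quotient; this section lifts to the middle term, so its connecting image is zero. Higher degrees
follow by shifting, the quotient being coinduced again. -/
lemma subsingleton_ext_coinduced (j : ℕ) (A : P → Type u) [∀ p, AddCommGroup (A p)] :
    Subsingleton (Abelian.Ext.{u} (constZ P) (coinduced A) (j + 1)) := by
  induction j generalizing A with
  | zero =>
    obtain ⟨B, C, f, g, w, _, hg, hS⟩ := exists_injective_coinduced_shortExact A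
    refine subsingleton_of_forall_eq 0 fun x => ?_
    obtain ⟨y, rfl⟩ := Abelian.Ext.covariant_sequence_exact₁ (constZ P) hS x
      (Abelian.Ext.eq_zero_of_injective _) (zero_add 1)
    obtain ⟨φ, rfl⟩ := Abelian.Ext.addEquiv₀.symm.surjective y
    obtain ⟨ψ, rfl⟩ := hom_constZ_coinduced_surjective g hg φ
    exact ((congrArg (fun t => Abelian.Ext.comp t hS.extClass (zero_add 1))
      (Abelian.Ext.mk₀_comp_mk₀ ψ (coinducedMap g)).symm).trans
        (Abelian.Ext.comp_assoc_of_second_deg_zero _ _ _ _)).trans (by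
          erw [hS.comp_extClass]
          simp)
  | succ j ih =>
    obtain ⟨B, C, f, g, w, _, hg, hS⟩ := exists_injective_coinduced_shortExact A
    refine subsingleton_of_forall_eq 0 fun x => ?_
    obtain ⟨y, rfl⟩ := Abelian.Ext.covariant_sequence_exact₁ (constZ P) hS x
      (Abelian.Ext.eq_zero_of_injective _) rfl
    have := ih (fun p => C p)
    exact (congrArg (fun t => Abelian.Ext.comp t hS.extClass rfl)
      (Subsingleton.elim y 0)).trans (Abelian.Ext.zero_comp _ _ _ _ _)

end Coinduced

end GradedPoset

/-! ### Derived limits as Ext groups -/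

/-- The homology of a short complex of abelian groups is computed by a surjection `ψ : B → A`
from a group `B` of cycles, if the kernel of `ψ` consists of the boundaries. -/
lemma CategoryTheory.ShortComplex.nonempty_ab_homology_iso (S : ShortComplex AddCommGrpCat.{u})
    {B : Type*} [AddCommGroup B] {A : AddCommGrpCat.{u}} (ι : B →+ S.X₂)
    (hι : Function.Injective ι) (hker : ∀ x, S.g.hom x = 0 ↔ ∃ b, ι b = x) (ψ : B →+ A)
    (hψ : Function.Surjective ψ) (hψ' : ∀ b, ψ b = 0 ↔ ∃ x, S.f.hom x = ι b) :
    Nonempty (S.homology ≅ A) := by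
  let e : B ≃+ S.g.hom.ker := AddEquiv.ofBijective
    (ι.codRestrict S.g.hom.ker fun b => (hker _).2 ⟨b, rfl⟩)
    ⟨fun a b h => hι (congrArg Subtype.val h), fun x => by
      obtain ⟨b, hb⟩ := (hker x).1 x.2
      exact ⟨b, Subtype.ext hb⟩⟩
  have he : ∀ x, ι (e.symm x) = x := fun x => congrArg Subtype.val (e.apply_symm_apply x)
  let φ : S.g.hom.ker →+ A := ψ.comp e.symm.toAddMonoidHom
  have hφ : Function.Surjective φ := hψ.comp e.symm.surjective
  have hrange : AddMonoidHom.range S.abToCycles = φ.ker := by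
    ext x
    refine Iff.trans ?_ (hψ' (e.symm x)).symm
    rw [he]
    exact ⟨fun ⟨y, hy⟩ => ⟨y, congrArg Subtype.val hy⟩, fun ⟨y, hy⟩ => ⟨y, Subtype.ext hy⟩⟩
  exact ⟨S.abHomologyIso ≪≫ ((QuotientAddGroup.quotientAddEquivOfEq hrange).trans
    (QuotientAddGroup.quotientKerEquivOfSurjective φ hφ)).toAddCommGrpIso⟩

namespace GradedPoset

variable {P : Type u} [PartialOrder P]

/-- The right derived functors of the limit are the groups `Ext` from the constant functor. -/
lemma nonempty_rightDerived_lim_iso_ext (F : P ⥤ AddCommGrpCat.{u}) (n : ℕ) :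
    Nonempty (((lim : (P ⥤ AddCommGrpCat.{u}) ⥤ AddCommGrpCat.{u}).rightDerived (n + 1)).obj F ≅
      AddCommGrpCat.of (Abelian.Ext.{u} (constZ P) F (n + 1))) := by
  -- One resolution computes both sides: `homLimEquiv` identifies `Hom(c_ℤ, I)` with `lim I`, and
  -- `extMk` sends cocycles onto `Ext`, killing exactly the coboundaries.
  let I := InjectiveResolution.of F
  let K := ((lim : (P ⥤ AddCommGrpCat.{u}) ⥤ AddCommGrpCat.{u}).mapHomologicalComplex
    (ComplexShape.up ℕ)).obj I.cocomplex
  let B := (Preadditive.rightComp (constZ P) (I.cocomplex.d (n + 1) (n + 2))).ker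
  let ψ : B →+ AddCommGrpCat.of (Abelian.Ext.{u} (constZ P) F (n + 1)) :=
    AddMonoidHom.mk' (fun f => I.extMk f.1 (n + 2) rfl f.2) fun f g =>
      (I.add_extMk f.1 g.1 (n + 2) rfl f.2 g.2).symm
  obtain ⟨e⟩ := (K.sc' n (n + 1) (n + 2)).nonempty_ab_homology_iso (A := AddCommGrpCat.of
      (Abelian.Ext.{u} (constZ P) F (n + 1)))
    ((homLimEquiv (I.cocomplex.X (n + 1))).toAddMonoidHom.comp B.subtype)
    ((homLimEquiv _).injective.comp Subtype.val_injective) (fun x => by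
      obtain ⟨f, rfl⟩ := (homLimEquiv (I.cocomplex.X (n + 1))).surjective x
      change (lim.map (I.cocomplex.d (n + 1) (n + 2))).hom _ = 0 ↔ _
      rw [← homLimEquiv_comp, map_eq_zero_iff _ (homLimEquiv _).injective]
      exact ⟨fun h => ⟨⟨f, h⟩, rfl⟩, fun ⟨b, hb⟩ => (homLimEquiv _).injective hb ▸ b.2⟩)
    ψ (fun y => by
      obtain ⟨f, hf, rfl⟩ := I.extMk_surjective y (n + 2) rfl
      exact ⟨⟨f, hf⟩, rfl⟩) (fun b => by
      refine (I.extMk_eq_zero_iff b.1 (n + 2) rfl b.2 n rfl).trans ?_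
      constructor
      · rintro ⟨g, hg⟩
        exact ⟨homLimEquiv _ g, by
          change (lim.map (I.cocomplex.d n (n + 1))).hom _ = homLimEquiv _ b.1
          rw [← homLimEquiv_comp, hg]⟩
      · rintro ⟨x, hx⟩
        obtain ⟨g, rfl⟩ := (homLimEquiv (I.cocomplex.X n)).surjective x
        refine ⟨g, (homLimEquiv _).injective ?_⟩
        rw [homLimEquiv_comp]
        exact hx)
  exact ⟨I.isoRightDerivedObj lim (n + 1) ≪≫
    K.homologyIsoSc' n (n + 1) (n + 2) (by simp) (by simp) ≪≫ e⟩

/-! ### Cycles, boundaries and cohomology of the complex -/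

section Complex

variable {deg : P → ℕ}

/-- A morphism `c_ℤ ⟶ F_n` as a family of elements in degree `n`. -/
noncomputable def restrictDegree (deg : P → ℕ) (n : ℕ) : (constZ P ⟶ seq deg n) →+ term deg n :=
  AddMonoidHom.mk' (fun f p => evalOne _ p.1 f) fun _ _ => funext fun _ => map_add _ _ _

lemma complex_d_hom_apply (n : ℕ) (x : term deg n) :
    ((complex deg).d n (n + 1)).hom x = (d deg n).hom x :=
  congrArg (fun t : term deg n ⟶ term deg (n + 1) => t.hom x) (CochainComplex.of_d _ _ _)

variable {n : ℕ} (hdeg : IsDegreeFunction deg) (hfin : ∀ p₀ : P, (Set.Ici p₀).Finite)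
  (hF : ∀ n, IsCondensed deg n (seq deg n))

include hdeg hfin hF

lemma section_ext {s t : ∀ p, (seq deg n).obj p}
    (hs : ∀ p q (h : p ≤ q), ((seq deg n).map (homOfLE h)).hom (s p) = s q)
    (ht : ∀ p q (h : p ≤ q), ((seq deg n).map (homOfLE h)).hom (t p) = t q)
    (h : ∀ p, deg p = n → s p = t p) : s = t := by
  funext p
  rw [← sub_eq_zero]
  refine (hF n).eq_zero hdeg hfin _ fun q hpq hq => ?_
  rw [map_sub, hs, ht, h q hq, sub_self]

lemma restrictDegree_injective : Function.Injective (restrictDegree deg n) := fun f g h =>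
  constZ_hom_ext fun p => congrFun (section_ext hdeg hfin hF (s := fun p => evalOne _ p f)
    (t := fun p => evalOne _ p g) (fun _ _ => map_evalOne f) (fun _ _ => map_evalOne g)
    fun p hp => congrFun h ⟨p, hp⟩) p

omit hdeg hfin hF in
lemma toKerPrime_apply (q : P) (x : term deg n) (p : Set.Ici q) (hp : deg p = n) :
    toKerPrime deg n q x p = tau deg n (seq deg n) p.1 (x ⟨p.1, hp⟩) := by
  change (if h : deg p.1 = n then _ else 0 : term deg n →+ _) x = _
  rw [dif_pos hp]
  rfl

lemma toKerPrime_eq {q : P} {x : term deg n} {y : ∀ p : Set.Ici q, kerAt (seq deg n) p}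
    (h : ∀ (p : Set.Ici q) (hp : deg p = n), (y p : (seq deg n).obj p) = x ⟨p.1, hp⟩) :
    toKerPrime deg n q x = y := by
  funext p
  by_cases hp : deg p = n
  · rw [toKerPrime_apply q x p hp]
    exact Subtype.ext (((hF n).coe_tau hdeg hfin hp _).trans (h p hp).symm)
  · have := (hF n).subsingleton_kerAt hp
    exact Subsingleton.elim _ _

lemma toLim_eq_zero_of_d_eq_zero {x : term deg n} (hx : (d deg n).hom x = 0) (q : P) :
    toLim deg n q x = 0 :=
  (hF (n + 1)).eq_zero hdeg hfin _ fun p hp hpn => by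
    rw [map_toLim]
    exact congrFun hx ⟨p, hpn⟩

/-- Left exactness of the limit: detection in degree `n + 1` turns `d x = 0` into the vanishing of
the section of `F_{n+1}` induced by `x`, so the section of `Ker'_{F_n}` comes from one of `F_n`. -/
lemma d_hom_eq_zero_iff (x : term deg n) :
    (d deg n).hom x = 0 ↔ ∃ f, restrictDegree deg n f = x := by
  constructor
  · intro hx
    have : ∀ q, ∃ s, lamAt deg n (seq deg n) q s = toKerPrime deg n q x := fun q =>
      (projAt_eq_zero_iff deg n q _).1 (toLim_eq_zero_of_d_eq_zero hdeg hfin hF hx q)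
    choose s hs using this
    have key : ∀ q p (h : q ≤ p) (hp : deg p = n),
        ((seq deg n).map (homOfLE h)).hom (s q) = x ⟨p, hp⟩ := fun q p h hp => by
      rw [← (hF n).coe_lamAt hdeg hfin (s q) ⟨p, h⟩ hp, hs, toKerPrime_apply q x ⟨p, h⟩ hp]
      exact (hF n).coe_tau hdeg hfin hp _
    -- The preimages were chosen independently; they are compatible because their restrictions agree
    -- in degree `n`.
    have hs' : ∀ p q (h : p ≤ q), ((seq deg n).map (homOfLE h)).hom (s p) = s q := by
      intro p q h
      rw [← sub_eq_zero]
      refine (hF n).eq_zero hdeg hfin _ fun r hr hrn => ?_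
      rw [map_sub, sub_eq_zero, key q r hr hrn, ← AddCommGrpCat.comp_apply,
        ← (seq deg n).map_comp]
      exact key p r _ hrn
    exact ⟨sectionHom s hs', funext fun p => (evalOne_sectionHom s hs' p.1).trans
      ((hs' p.1 p.1 le_rfl).symm.trans (key p.1 p.1 le_rfl p.2))⟩
  · rintro ⟨f, rfl⟩
    funext q
    refine (projAt_eq_zero_iff deg n q.1 (toKerPrime deg n q.1 (restrictDegree deg n f))).2 ?_
    refine ⟨evalOne _ q.1 f, (toKerPrime_eq hdeg hfin hF fun p hp => ?_).symm⟩
    rw [(hF n).coe_lamAt hdeg hfin _ _ hp]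
    exact map_evalOne f _

lemma exists_d_eq_restrictDegree_iff (f : constZ P ⟶ seq deg (n + 1)) :
    (∃ g : constZ P ⟶ kerPrime (seq deg n), g ≫ proj deg n = f) ↔
      ∃ x, (d deg n).hom x = restrictDegree deg (n + 1) f := by
  constructor
  · rintro ⟨g, rfl⟩
    let y : ∀ q (p : Set.Ici q), kerAt (seq deg n) p := fun q => evalOne (kerPrime (seq deg n)) q g
    -- A section of a coinduced functor is determined by its diagonal entries, and those outside
    -- degree `n` lie in zero groups.
    refine ⟨fun p => y p.1 ⟨p.1, le_rfl⟩, funext fun q => ?_⟩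
    change projAt deg n q.1 (toKerPrime deg n q.1 _) = projAt deg n q.1 (y q.1)
    congr 1
    refine toKerPrime_eq hdeg hfin hF fun p hp => ?_
    exact congrArg Subtype.val (congrFun (map_evalOne g p.2).symm ⟨p.1, le_rfl⟩).symm
  · rintro ⟨x, hx⟩
    refine ⟨sectionHom (F := kerPrime (seq deg n)) (fun q => toKerPrime deg n q x)
      fun _ _ _ => rfl, restrictDegree_injective hdeg hfin hF ?_⟩
    rw [← hx]
    funext q
    exact congrArg ((proj deg n).app q.1).hom
      (evalOne_sectionHom (F := kerPrime (seq deg n)) (fun q => toKerPrime deg n q x)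
        (fun _ _ _ => rfl) q.1)

lemma nonempty_complex_homology_iso_cohomology (n : ℕ) :
    Nonempty ((complex deg).homology n ≅ cohomology P n) := by
  cases n with
  | zero =>
    obtain ⟨e⟩ := ((complex deg).sc' 0 0 1).nonempty_ab_homology_iso (A := lim.obj (constZ P))
      (restrictDegree deg 0) (restrictDegree_injective hdeg hfin hF) (fun x =>
        (complex_d_hom_apply 0 x).congr_left.trans (d_hom_eq_zero_iff hdeg hfin hF x))
      (homLimEquiv (constZ P)).toAddMonoidHom (homLimEquiv _).surjective (fun b => by
        have h1 : homLimEquiv (constZ P) b = 0 ↔ b = 0 :=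
          map_eq_zero_iff _ (homLimEquiv _).injective
        have h2 : restrictDegree deg 0 b = 0 ↔ b = 0 :=
          map_eq_zero_iff _ (restrictDegree_injective hdeg hfin hF)
        refine h1.trans (h2.symm.trans ?_)
        -- In degree 0 the incoming map of the short complex is the zero map `d 0 0`, so there are
        -- no boundaries.
        have h3 : ∀ x, ((complex deg).d 0 0).hom x = 0 := fun x => by
          rw [(complex deg).shape 0 0 (by simp)]
          rfl
        exact ⟨fun h => ⟨0, (h3 0).trans h.symm⟩, fun ⟨x, hx⟩ => hx.symm.trans (h3 x)⟩)
    exact ⟨(complex deg).homologyIsoSc' 0 0 1 (by simp) (by simp) ≪≫ e ≪≫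
      ((lim : (P ⥤ AddCommGrpCat.{u}) ⥤ AddCommGrpCat.{u}).rightDerivedZeroIsoSelf.app
        (constZ P)).symm⟩
  | succ n =>
    obtain ⟨ψ, hψ, hψ'⟩ := Abelian.Ext.exists_dimensionShift (constZ P) n (seq deg)
      (fun n => kerPrime (seq deg n)) (fun n => lam deg n (seq deg n)) (proj deg) (lam_proj deg)
      (fun n => shortExact_seqShortComplex hdeg hfin (hF n))
      (fun n j => subsingleton_ext_coinduced j _)
    obtain ⟨e⟩ := ((complex deg).sc' n (n + 1) (n + 2)).nonempty_ab_homology_iso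
      (A := AddCommGrpCat.of (Abelian.Ext.{u} (constZ P) (constZ P) (n + 1)))
      (restrictDegree deg (n + 1)) (restrictDegree_injective hdeg hfin hF) (fun x =>
        (complex_d_hom_apply (n + 1) x).congr_left.trans (d_hom_eq_zero_iff hdeg hfin hF x))
      ψ hψ (fun b => by
        refine (hψ' b).trans ((exists_d_eq_restrictDegree_iff hdeg hfin hF b).trans ?_)
        exact exists_congr fun x => (complex_d_hom_apply n x).symm.congr_left)
    obtain ⟨e'⟩ := nonempty_rightDerived_lim_iso_ext (constZ P) n
    exact ⟨(complex deg).homologyIsoSc' n (n + 1) (n + 2) (by simp) (by simp) ≪≫ e ≪≫ e'.symm⟩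

end Complex

end GradedPoset

theorem theorem4p6 {P : Type u} [PartialOrder P] (deg : P → ℕ)
    (hdeg : GradedPoset.IsDegreeFunction deg)
    (hfin : ∀ p₀ : P, (Set.Ici p₀).Finite)
    (hJ : ∃ J : P → ℕ → Set P,
      GradedPoset.IsLocalCoveringFamily deg J ∧ GradedPoset.IsAdequate deg J) :
    -- the functors are condensed, free, of the stated ranks, and fit in short exact sequences
    (∀ n : ℕ, GradedPoset.IsCondensed deg n (GradedPoset.seq deg n) ∧
      (GradedPoset.seqShortComplex deg n).ShortExact ∧
      ∀ p : P, Module.Free ℤ ((GradedPoset.seq deg n).obj p) ∧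
        Module.Finite ℤ ((GradedPoset.seq deg n).obj p) ∧
        (n ≤ deg p →
          (Module.finrank ℤ ((GradedPoset.seq deg n).obj p) : ℤ) = GradedPoset.R deg n p)) ∧
    -- the complex computes the cohomology of the poset
    (∀ n : ℕ, Nonempty ((GradedPoset.complex deg).homology n ≅ GradedPoset.cohomology P n)) ∧
    -- a term indexed by finitely many objects is free, of the stated rank
    (∀ n : ℕ, {p : P | deg p = n}.Finite →
      Module.Free ℤ (GradedPoset.term deg n) ∧
      Module.Finite ℤ (GradedPoset.term deg n) ∧
      (Module.finrank ℤ (GradedPoset.term deg n) : ℤ) =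
        ∑ᶠ p ∈ {p : P | deg p = n}, GradedPoset.R deg n p) := by
  obtain ⟨J, hJ, hA⟩ := hJ
  have hF := GradedPoset.isFreeCondensed_seq hdeg hfin hJ hA
  refine ⟨fun n => ⟨(hF n).condensed,
    GradedPoset.shortExact_seqShortComplex hdeg hfin (hF n).condensed,
    fun p => ⟨(hF n).free p, (hF n).finite p, (hF n).finrank_eq p⟩⟩,
    GradedPoset.nonempty_complex_homology_iso_cohomology hdeg hfin fun n => (hF n).condensed,
    fun n hn => GradedPoset.free_finite_finrank_term (hF n) hn⟩
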